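/- Let $X$ be a real Hausdorff locally convex space with topological dual $X^*$, and let $\Gamma_0(X)$ be the set of proper (that is, nowhere $-\infty$ and not identically $+\infty$), lower semicontinuous, convex functions $g:X\to\mathbb{R}\cup\{+\infty\}$. Write $\operatorname{dom} g=\{x: g(x)<+\infty\}$, and for $\varepsilon\ge 0$ let $\partial_\varepsilon g(x)=\{x^*\in X^*: \langle x^*,y-x\rangle\le g(y)-g(x)+\varepsilon\ \ \forall y\in X\}$ if $g(x)$ is finite, $\partial_\varepsilon g(x)=\emptyset$ otherwise, and $\partial g=\partial_0 g$. Let $\operatorname{ri}(A)$ denote the interior of $A$ relative to its affine hull $\operatorname{aff}(A)$, and $\operatorname{cl}^{w^*}$ the closure in the weak$^*$ topology of $X^*$. Sums of sets are Minkowski sums, with the empty sum of sets equal to $\{0\}$; the intersection of an empty family of subsets of $X$ is $X$. Let $T$ be a finite set, $\{f_t\}_{t\in T}\subseteq\Gamma_0(X)$, $T_0\subseteq T$ and $T_0^c=T\setminus T_0$. Then the following hold. (i) If $\bigcap_{t\in T_0}\operatorname{ri}(\operatorname{dom} f_t)\cap\bigcap_{t\in T_0^c}\operatorname{dom} f_t\neq\emptyset$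 and, for each $t\in T_0$, the restriction of $f_t$ to $\operatorname{ri}(\operatorname{dom} f_t)$ is continuous, then for every $x\in X$ $$\partial\Bigl(\sum_{t\in T}f_t\Bigr)(x)=\bigcap_{\varepsilon>0}\operatorname{cl}^{w^*}\Bigl\{\sum_{t\in T_0}\partial f_t(x)+\sum_{t\in T_0^c}\partial_\varepsilon f_t(x)\Bigr\}.$$ (ii) If $\bigcap_{t\in T_0}\operatorname{int}(\operatorname{dom} f_t)\cap\bigcap_{t\in T_0^c}\operatorname{dom} f_t\neq\emptyset$ and each $f_t$ with $t\in T_0$ is continuous on $\operatorname{int}(\operatorname{dom} f_t)$, then for every $x\in X$ $$\partial\Bigl(\sum_{t\in T}f_t\Bigr)(x)=\sum_{t\in T_0}\partial f_t(x)+\bigcap_{\varepsilon>0}\operatorname{cl}^{w^*}\Bigl\{\sum_{t\in T_0^c}\partial_\varepsilon f_t(x)\Bigr\}.$$ -/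

import Mathlib

open scoped Pointwise

namespace ConvexSum

variable {X : Type*}

/-- The effective domain of an extended-real-valued function. -/
def dom (f : X → EReal) : Set X := {x | f x < ⊤}

/-- A function is proper if its domain is nonempty and it never takes the value `-∞`. -/
def IsProper (f : X → EReal) : Prop := (dom f).Nonempty ∧ ∀ x, ⊥ < f x

variable [AddCommGroup X] [Module ℝ X] [TopologicalSpace X]

/-- Membership in `Γ₀(X)`: proper, lower semicontinuous and convex (convex epigraph). -/
structure IsGammaZero (f : X → EReal) : Prop where
  proper : IsProper f
  lsc : LowerSemicontinuous f
  convex : Convex ℝ {p : X × ℝ | f p.1 ≤ (p.2 : EReal)}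

/-- The `ε`-subdifferential of `f` at `x`, a subset of the topological dual with the weak-star
topology; it is empty if `f x` is not finite. -/
def epsSubdiff (ε : ℝ) (f : X → EReal) (x : X) : Set (WeakDual ℝ X) :=
  {p | f x ≠ ⊤ ∧ f x ≠ ⊥ ∧ ∀ y : X, ((p (y - x) : ℝ) : EReal) ≤ f y - f x + (ε : EReal)}

/-- The (exact) subdifferential is the `0`-subdifferential. -/
def subdiff (f : X → EReal) (x : X) : Set (WeakDual ℝ X) := epsSubdiff 0 f x

end ConvexSum

/-!
The inclusions `⊇` only use that a sum of `ε`-subgradients is a `|T| * ε`-subgradient of the sum and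
that pointwise inequalities pass to weak-star limits. The content is in the inclusions `⊆`, which
are reduced to Hahn–Banach separations in `X × ℝ` of epigraphs from suitable convex sets.

For the first formula, let `p` be a subgradient of the sum at `x`, and suppose that it is not in the
weak-star closure of the sum of the sets `A t`, where `A t` is `∂ f t (x)` for `t ∈ T₀` and
`∂_ε f t (x)` otherwise. A separating weak-star continuous functional is the evaluation at some
`u : X`, so `p u` exceeds the sum of bounds `m t` for the values at `u` of the elements of `A t`.
Let `x₀` be the point of the qualification condition and `w = (1 - r) • u + r • (x₀ - x)` with a
small `r > 0`. It suffices that each `f t` satisfies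
`f t (x + s • w) ≤ f t x + s * ((1 - r) * m t + O(r))` for some `s > 0`, hence by convexity for all
smaller `s`: adding these inequalities and dividing by `s` bounds `p w`, and `r → 0` contradicts
`∑ t, m t < p u`.

* For `t ∉ T₀` this is `exists_descent_of_epsSubgradient_le`: if there is no descent in the
  direction `u`, a long segment starting at height `f t x - ε` is compact and disjoint from the
  closed epigraph, and the functional that separates the two is an `ε`-subgradient of too large a
  slope along `u`.
* For `t ∈ T₀` this is `exists_descent_of_subgradient_le`. Lower semicontinuity together with
  continuity on the relative interior bounds `f t` near `x₀` on a translate of a closed subspace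
  containing the domain (`isRelBoundedNear_of_mem_intrinsicInterior`). That bound makes exact
  separation of the epigraph possible (`exists_separating_subgradient`), and the convex combination
  with `x₀ - x` moves `u`, which is a limit of feasible directions, to a feasible direction around
  which `f t` is still bounded.

The second formula combines the case `T₀ = ∅` of the first one, applied to the functions with
`t ∉ T₀`, with the exact sum rule `exists_add_of_mem_subdiff_sum` for functions that are continuous
at a common point; the latter follows again from `exists_separating_subgradient`.
-/

namespace ConvexSum

/-! ### Difference quotients of convex functions -/

theorem descent_of_le {X : Type*} [AddCommGroup X] [Module ℝ X] {E : Set (X × ℝ)}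
    (hE : Convex ℝ E) {x : X} {a : ℝ} (hx : (x, a) ∈ E)
    {w : X} {μ s s' : ℝ} (h : (x + s • w, a + s * μ) ∈ E) (hs' : 0 < s') (hs : s' ≤ s) :
    (x + s' • w, a + s' * μ) ∈ E := by
  have h0 : 0 < s := hs'.trans_le hs
  have := hE hx h (sub_nonneg.2 ((div_le_one h0).2 hs)) (div_pos hs' h0).le (by ring)
  convert this using 1
  ext
  · simp only [Prod.fst_add, Prod.smul_fst, smul_add, smul_smul, div_mul_cancel₀ _ h0.ne']
    module
  · simp only [Prod.snd_add, Prod.smul_snd, smul_eq_mul]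
    field_simp
    ring

theorem descent_combo {X : Type*} [AddCommGroup X] [Module ℝ X]
    {E : Set (X × ℝ)} (hE : Convex ℝ E) {x : X} {a : ℝ} (hx : (x, a) ∈ E)
    {u v : X} {μ ν t : ℝ} (ht0 : 0 ≤ t) (ht1 : t ≤ 1)
    (hu : ∃ s : ℝ, 0 < s ∧ (x + s • u, a + s * μ) ∈ E)
    (hv : ∃ s : ℝ, 0 < s ∧ (x + s • v, a + s * ν) ∈ E) :
    ∃ s : ℝ, 0 < s ∧
      (x + s • ((1 - t) • u + t • v), a + s * ((1 - t) * μ + t * ν)) ∈ E := by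
  obtain ⟨s, hs, hu⟩ := hu
  obtain ⟨s', hs', hv⟩ := hv
  have h0 := lt_min hs hs'
  refine ⟨min s s', h0, ?_⟩
  have := hE (descent_of_le hE hx hu h0 (min_le_left _ _))
    (descent_of_le hE hx hv h0 (min_le_right _ _)) (sub_nonneg.2 ht1) ht0 (by ring)
  convert this using 1
  ext
  · simp only [Prod.fst_add, Prod.smul_fst]
    module
  · simp only [Prod.snd_add, Prod.smul_snd, smul_eq_mul]
    ring

/-! ### Separation of epigraphs -/

variable {X : Type*} [AddCommGroup X] [Module ℝ X] [TopologicalSpace X]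

theorem exists_continuous_seminorm_of_mem_nhds [IsTopologicalAddGroup X] [ContinuousSMul ℝ X]
    [LocallyConvexSpace ℝ X] {x : X} {N : Set X} (hN : N ∈ nhds x) :
    ∃ q : Seminorm ℝ X, Continuous q ∧ ∀ v, q v < 1 → x + v ∈ N := by
  have h0 : (fun v => x + v) ⁻¹' N ∈ nhds (0 : X) :=
    (continuous_const.add continuous_id).continuousAt.preimage_mem_nhds (by simpa using hN)
  obtain ⟨s, hs, hsN⟩ := (nhds_hasBasis_absConvex_open ℝ X).mem_iff.1 h0
  let S : AbsConvexOpenSets ℝ X := ⟨s, hs⟩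
  refine ⟨gaugeSeminormFamily ℝ X S, with_gaugeSeminormFamily.continuous_seminorm S, fun v hv => ?_⟩
  refine hsN ?_
  have h : v ∈ (gaugeSeminormFamily ℝ X S).ball 0 1 := by simpa using hv
  rwa [gaugeSeminormFamily_ball] at h

theorem map_prod_real_eq (φ : X × ℝ →L[ℝ] ℝ) (y : X) (τ : ℝ) :
    φ (y, τ) = φ.comp (ContinuousLinearMap.inl ℝ X ℝ) y + τ * φ (0, 1) := by
  have : (y, τ) = (y, (0 : ℝ)) + τ • ((0 : X), (1 : ℝ)) := by simp
  rw [this, map_add, map_smul]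
  simp

/-- A form of the exact sum rule: `p ∈ ∂(f + g)(x)` implies `p ∈ ∂f(x) + ∂g(x)`, for the convex
functions `f` and `g` with epigraphs `F` and `G` and the values `a` and `b` at `x`. Both are defined
on a translate of a subspace `V`, relative to which `f` is bounded above by `M` near a point `x₀` of
the domain of `g`.

The bound on `f` implies that `F` is disjoint not only from the reflected epigraph of `g`, but also
from its sum with an open convex cone of slope `K`. The sum is open in the whole of `X × ℝ`, so that
no extension of functionals from `V` is needed. -/
theorem exists_separating_subgradient [IsTopologicalAddGroup X] [ContinuousSMul ℝ X]
    {F G : Set (X × ℝ)} (hF : Convex ℝ F) (hG : Convex ℝ G) {x x₀ : X} {a b M σ₀ r : ℝ}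
    (hxF : (x, a) ∈ F) (hxG : (x, b) ∈ G) (p : X →L[ℝ] ℝ)
    (hp : ∀ y τ σ, (y, τ) ∈ F → (y, σ) ∈ G → a + b + p (y - x) ≤ τ + σ)
    (V : Submodule ℝ X) (q : Seminorm ℝ X) (hq : Continuous q) (hr : 0 < r)
    (hM : ∀ v ∈ V, q v < r → (x₀ + v, M) ∈ F) (hx₀ : (x₀, σ₀) ∈ G)
    (hV : ∀ y z τ σ, (y, τ) ∈ F → (z, σ) ∈ G → y - z ∈ V) :
    ∃ l : X →L[ℝ] ℝ, (∀ y τ, (y, τ) ∈ F → l (y - x) ≤ τ - a) ∧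
      ∀ y σ, (y, σ) ∈ G → p (y - x) - l (y - x) ≤ σ - b := by
  have hM0 : (x₀, M) ∈ F := by simpa using hM 0 V.zero_mem (by simpa using hr)
  set C := M + σ₀ - (a + b + p (x₀ - x)) with hC
  have hC0 : 0 ≤ C := by have := hp _ _ _ hM0 hx₀; linarith
  -- `C + 1` in place of `C` makes the cone narrow enough for a strict contradiction below
  set K := (C + 1) / r with hK
  have hK0 : 0 < K := by positivity
  -- an open cone with vertex at height `a + b - p x`, opening downwards with slope `K`
  set P : Set (X × ℝ) := {w | w.2 + K * q w.1 < a + b - p x} with hP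
  have hPo : IsOpen P := by
    apply isOpen_lt _ continuous_const
    have : Continuous fun w : X × ℝ => q w.1 := hq.comp continuous_fst
    fun_prop
  have hPc : Convex ℝ P := by
    intro w hw w' hw' s t hs ht hst
    simp only [hP, Set.mem_ofPred_eq, Prod.snd_add, Prod.smul_snd, Prod.fst_add, Prod.smul_fst,
      smul_eq_mul] at hw hw' ⊢
    have h1 : q (s • w.1 + t • w'.1) ≤ s * q w.1 + t * q w'.1 := by
      refine (map_add_le_add q _ _).trans (le_of_eq ?_)
      rw [map_smul_eq_mul, map_smul_eq_mul, Real.norm_of_nonneg hs, Real.norm_of_nonneg ht]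
    have h2 := mul_le_mul_of_nonneg_left h1 hK0.le
    have h3 := (convex_Iio (𝕜 := ℝ) (a + b - p x)) hw hw' hs ht hst
    simp only [smul_eq_mul, Set.mem_Iio] at h3
    linarith
  let L : X × ℝ →ₗ[ℝ] X × ℝ :=
    (LinearMap.fst ℝ X ℝ).prod ((p : X →ₗ[ℝ] ℝ).comp (LinearMap.fst ℝ X ℝ) - LinearMap.snd ℝ X ℝ)
  set Q := L '' G + P with hQ
  have hQo : IsOpen Q := hPo.add_left
  have hQc : Convex ℝ Q := (hG.linear_image L).add hPc
  have hmemQ : ∀ y σ ρ, (y, σ) ∈ G → ρ < a + b - p x → (y, p y - σ + ρ) ∈ Q := by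
    intro y σ ρ hy hρ
    refine ⟨(y, p y - σ), ⟨(y, σ), hy, rfl⟩, (0, ρ), ?_, by simp⟩
    simpa [hP] using hρ
  have hdisj : Disjoint Q F := by
    rw [Set.disjoint_left]
    rintro _ ⟨_, ⟨⟨y, σ⟩, hy, rfl⟩, ⟨z, ρ⟩, hz, rfl⟩ hF'
    have hF' : (y + z, p y - σ + ρ) ∈ F := hF'
    simp only [hP, Set.mem_ofPred_eq] at hz
    have hzV : z ∈ V := by simpa using hV _ _ _ _ hF' hy
    have hqz := apply_nonneg q z
    set β := a + b - p x - ρ with hβ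
    have hβK : K * q z < β := by linarith
    have hβ0 : 0 < β := lt_of_le_of_lt (by positivity) hβK
    -- move from `y + z` towards `x₀ - η • z`, which is in the domain, to get a point where both
    -- `f` and `g` are controlled
    set η := (C + 1) / β with hη
    have hη0 : 0 < η := by positivity
    have hηβ : η * β = C + 1 := by rw [hη]; field_simp
    have hKr : K * r = C + 1 := by rw [hK]; field_simp
    have hqη : q (-(η • z)) < r := by
      rw [map_neg_eq_map, map_smul_eq_mul, Real.norm_of_nonneg hη0.le]
      have : η * (K * q z) < η * β := by gcongr
      rw [hηβ, ← hKr] at this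
      have h' : K * (η * q z) < K * r := by linarith
      exact lt_of_mul_lt_mul_left h' hK0.le
    have h1 := hM _ (V.neg_mem (V.smul_mem η hzV)) hqη
    have hs : 0 < 1 + η := by positivity
    have e1 : η / (1 + η) + 1 / (1 + η) = 1 := by field_simp; ring
    have f1 := hF hF' h1 (by positivity) (by positivity) e1
    have g1 := hG hy hx₀ (by positivity) (by positivity) e1
    simp only [Prod.smul_mk, Prod.mk_add_mk, smul_eq_mul] at f1 g1
    have e2 : (η / (1 + η)) • (y + z) + (1 / (1 + η)) • (x₀ + -(η • z)) =
        (η / (1 + η)) • y + (1 / (1 + η)) • x₀ := by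
      rw [smul_add, smul_add, smul_neg, smul_smul, one_div_mul_eq_div]; abel
    rw [e2] at f1
    have h2 := hp _ _ _ f1 g1
    simp only [map_add, map_sub, map_smul, smul_eq_mul] at h2
    have h3 := mul_le_mul_of_nonneg_left h2 hs.le
    have h4 : (1 + η) * (a + b + (η / (1 + η) * p y + 1 / (1 + η) * p x₀ - p x)) =
      (1 + η) * (a + b - p x) + η * p y + p x₀ := by field_simp; ring
    have h5 : (1 + η) * (η / (1 + η) * (p y - σ + ρ) + 1 / (1 + η) * M +
      (η / (1 + η) * σ + 1 / (1 + η) * σ₀)) = η * (p y + ρ) + M + σ₀ := by field_simp; ring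
    rw [h4, h5] at h3
    have h6 : p (x₀ - x) = p x₀ - p x := map_sub _ _ _
    rw [h6] at hC
    have h7 : η * β = η * (a + b - p x) - η * ρ := by rw [hβ]; ring
    linarith
  obtain ⟨φ, c, hφQ, hφF⟩ := geometric_hahn_banach_open hQc hQo hF hdisj
  set k := φ (0, 1) with hk
  set m : X →L[ℝ] ℝ := φ.comp (ContinuousLinearMap.inl ℝ X ℝ) with hm
  have hφ : ∀ y τ, φ (y, τ) = m y + τ * k := map_prod_real_eq φ
  have hQ' : ∀ y σ ρ, (y, σ) ∈ G → ρ < a + b - p x → m y + (p y - σ + ρ) * k < c := by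
    intro y σ ρ hy hρ
    rw [← hφ]; exact hφQ _ (hmemQ y σ ρ hy hρ)
  have hF' : ∀ y τ, (y, τ) ∈ F → c ≤ m y + τ * k := by
    intro y τ hy; rw [← hφ]; exact hφF _ hy
  -- the separating hyperplane is not vertical, since `x₀` is in both domains
  have hk0 : 0 < k := by
    have hMc := hF' _ _ hM0
    by_contra hk0
    push Not at hk0
    have hρ : min (a + b - p x - 1) (M + σ₀ - p x₀) < a + b - p x :=
      (min_le_left _ _).trans_lt (by linarith)
    have h1 := hQ' _ _ _ hx₀ hρ
    have h2 : p x₀ - σ₀ + min (a + b - p x - 1) (M + σ₀ - p x₀) ≤ M := by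
      have := min_le_right (a + b - p x - 1) (M + σ₀ - p x₀); linarith
    have := mul_le_mul_of_nonpos_right h2 hk0
    linarith
  have hQ'' : ∀ y σ, (y, σ) ∈ G → m y + (p y - σ + (a + b - p x)) * k ≤ c := by
    intro y σ hy
    refine le_of_forall_pos_le_add fun ε hε => ?_
    have := hQ' y σ (a + b - p x - ε / k) hy (by have := div_pos hε hk0; linarith)
    have e : ε / k * k = ε := by field_simp
    nlinarith
  have hxc : m x + a * k = c := by
    refine le_antisymm ?_ (hF' _ _ hxF)
    have := hQ'' _ _ hxG
    have e : p x - b + (a + b - p x) = a := by ring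
    rwa [e] at this
  refine ⟨-(k⁻¹ • m), fun y τ hy => ?_, fun y σ hy => ?_⟩
  · have := hF' _ _ hy
    simp only [neg_apply, smul_apply, map_sub, smul_eq_mul]
    rw [← mul_le_mul_iff_of_pos_right hk0]
    field_simp
    linarith
  · have := hQ'' _ _ hy
    simp only [neg_apply, smul_apply, map_sub, smul_eq_mul]
    rw [← mul_le_mul_iff_of_pos_right hk0]
    field_simp
    linarith

/-! ### Subgradients and descent -/

/-- If all `ε`-subgradients at `x` of the closed convex function with epigraph `E` are at most `m`
in the direction `u`, the function has a difference quotient of at most `m + δ` in that direction.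
The functional separating `E` from a long segment that starts at height `a - ε` is an
`ε`-subgradient, and its slope along `u` is known from the far end up to `ε` over the length. -/
theorem exists_descent_of_epsSubgradient_le [IsTopologicalAddGroup X] [ContinuousSMul ℝ X]
    [LocallyConvexSpace ℝ X] {E : Set (X × ℝ)} (hE : Convex ℝ E) (hEc : IsClosed E)
    (hup : ∀ y τ τ', (y, τ) ∈ E → τ ≤ τ' → (y, τ') ∈ E) {x : X} {a ε : ℝ}
    (hx : (x, a) ∈ E) (ha : ∀ τ, (x, τ) ∈ E → a ≤ τ) (hε : 0 < ε) {u : X} {m : ℝ}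
    (hm : ∀ l : X →L[ℝ] ℝ, (∀ y τ, (y, τ) ∈ E → l (y - x) ≤ τ - a + ε) → l u ≤ m) {δ : ℝ}
    (hδ : 0 < δ) : ∃ s : ℝ, 0 < s ∧ (x + s • u, a + s * (m + δ)) ∈ E := by
  by_contra hcon
  push Not at hcon
  -- with this length the error `ε / N` in the slope at the far end of the segment is `δ`
  set N := ε / δ with hN
  have hN0 : 0 < N := div_pos hε hδ
  have hNδ : N * δ = ε := div_mul_cancel₀ _ hδ.ne'
  set S := segment ℝ (x, a - ε) (x + N • u, a - ε + N * (m + δ)) with hS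
  have hSc : IsCompact S := by
    rw [hS, segment_eq_image']
    exact isCompact_Icc.image (by fun_prop)
  have hdisj : Disjoint S E := by
    rw [Set.disjoint_left]
    rintro ⟨y, τ⟩ hy hyE
    rw [hS, segment_eq_image'] at hy
    obtain ⟨s, hs, h⟩ := hy
    simp only [Prod.mk_sub_mk, Prod.smul_mk, Prod.mk_add_mk, Prod.mk.injEq, smul_eq_mul,
      add_sub_cancel_left, smul_smul] at h
    obtain ⟨rfl, rfl⟩ := h
    rcases hs.1.eq_or_lt with rfl | hs0
    · have := ha (a - ε) (by simpa using hyE)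
      linarith
    · have hsN : 0 < s * N := mul_pos hs0 hN0
      exact hcon (s * N) hsN (hup _ _ _ hyE (by linarith))
  obtain ⟨φ, c, c', hφS, hc, hφE⟩ := geometric_hahn_banach_compact_closed
    (convex_segment (𝕜 := ℝ) _ _) hSc hE hEc hdisj
  set k := φ (0, 1) with hk
  set n : X →L[ℝ] ℝ := φ.comp (ContinuousLinearMap.inl ℝ X ℝ) with hn
  have hφ : ∀ y τ, φ (y, τ) = n y + τ * k := map_prod_real_eq φ
  have h0 := hφS _ (left_mem_segment ℝ (x, a - ε) (x + N • u, a - ε + N * (m + δ)))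
  have h1 := hφS _ (right_mem_segment ℝ (x, a - ε) (x + N • u, a - ε + N * (m + δ)))
  have h2 := hφE _ hx
  rw [hφ] at h0 h1 h2
  have hk0 : 0 < k := by
    by_contra hk0
    push Not at hk0
    have := mul_nonpos_of_nonneg_of_nonpos hε.le hk0
    linarith
  have h3 := hm (-(k⁻¹ • n)) (fun y τ hy => by
    have h3 := hφE _ hy
    rw [hφ] at h3
    simp only [neg_apply, smul_apply, map_sub, smul_eq_mul]
    rw [← mul_le_mul_iff_of_pos_right hk0]
    field_simp
    linarith)
  simp only [neg_apply, smul_apply, smul_eq_mul] at h3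
  rw [← mul_le_mul_iff_of_pos_right hk0] at h3
  field_simp at h3
  simp only [map_add, map_smul, smul_eq_mul] at h1
  have h4 := mul_le_mul_of_nonneg_left h3 hN0.le
  rw [← hNδ] at h1
  linarith

/-- If a convex function, with epigraph `E`, decreases at rate at most `-c` on the segment from `x`
to `x₁`, and is bounded above near `x₁` relative to a subspace `V` containing the directions of its
domain, some subgradient at `x` has slope at least `c` along the segment. -/
theorem exists_subgradient_ge [IsTopologicalAddGroup X] [ContinuousSMul ℝ X]
    {E : Set (X × ℝ)} (hE : Convex ℝ E) {x x₁ : X} {a M r c : ℝ} (hx : (x, a) ∈ E)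
    (V : Submodule ℝ X) (hV : ∀ y τ, (y, τ) ∈ E → y - x ∈ V) (q : Seminorm ℝ X)
    (hq : Continuous q) (hr : 0 < r) (hM : ∀ v ∈ V, q v < r → (x₁ + v, M) ∈ E)
    (hc : ∀ s τ : ℝ, 0 ≤ s → s ≤ 1 → (x + s • (x₁ - x), τ) ∈ E → a + s * c ≤ τ) :
    ∃ l : X →L[ℝ] ℝ, (∀ y τ, (y, τ) ∈ E → l (y - x) ≤ τ - a) ∧ c ≤ l (x₁ - x) := by
  have hx₁ : x₁ - x ∈ V := hV _ M (by simpa using hM 0 V.zero_mem (by simpa using hr))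
  -- the graph over the segment of the affine function with slope `-c`
  set G : Set (X × ℝ) := segment ℝ (x, (0 : ℝ)) (x₁, -c) with hG
  have hGmem : ∀ y σ, (y, σ) ∈ G →
      ∃ s : ℝ, 0 ≤ s ∧ s ≤ 1 ∧ y = x + s • (x₁ - x) ∧ σ = -(s * c) := by
    intro y σ hy
    rw [hG, segment_eq_image'] at hy
    obtain ⟨s, hs, h⟩ := hy
    simp only [Prod.mk_sub_mk, Prod.smul_mk, Prod.mk_add_mk, Prod.mk.injEq, smul_eq_mul] at h
    exact ⟨s, hs.1, hs.2, h.1.symm, by rw [← h.2]; ring⟩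
  obtain ⟨l, hlF, hlG⟩ := exists_separating_subgradient (x₀ := x₁) (M := M) (r := r) hE
    (convex_segment (𝕜 := ℝ) (x, (0 : ℝ)) (x₁, -c)) hx (left_mem_segment _ _ _) 0
    (fun y τ σ hy hy' => by
      obtain ⟨s, h0, h1, rfl, rfl⟩ := hGmem _ _ hy'
      have := hc s τ h0 h1 hy
      simp only [zero_apply]; linarith) V q hq hr hM (right_mem_segment _ _ _)
    (fun y z τ σ hy hz => by
      obtain ⟨s, h0, h1, rfl, rfl⟩ := hGmem _ _ hz
      rw [← sub_sub]
      exact V.sub_mem (hV _ _ hy) (V.smul_mem _ hx₁))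
  refine ⟨l, hlF, ?_⟩
  have := hlG _ _ (right_mem_segment ℝ (x, (0 : ℝ)) (x₁, -c))
  simp only [zero_apply] at this
  linarith

/-- The counterpart of `exists_descent_of_epsSubgradient_le` for exact subgradients. Descent is only
obtained in the directions between `u` and `x₀ - x`, where `x₀` is a point at which the function is
bounded above relative to the subspace `V`. -/
theorem exists_descent_of_subgradient_le [IsTopologicalAddGroup X] [ContinuousSMul ℝ X]
    [LocallyConvexSpace ℝ X] {E : Set (X × ℝ)} (hE : Convex ℝ E)
    (hup : ∀ y τ τ', (y, τ) ∈ E → τ ≤ τ' → (y, τ') ∈ E) {x x₀ : X} {a M k c : ℝ}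
    (hx : (x, a) ∈ E) (V : Submodule ℝ X) (hVc : IsClosed (V : Set X))
    (hV : ∀ y τ, (y, τ) ∈ E → y - x ∈ V) (q : Seminorm ℝ X)
    (hq : Continuous q) (hM : ∀ v ∈ V, q v < 1 → (x₀ + v, M) ∈ E) (hk : (x₀, k) ∈ E)
    (hc : ∀ s τ : ℝ, 0 ≤ s → s ≤ 1 → (x + s • (x₀ - x), τ) ∈ E → a + s * c ≤ τ)
    {u : X} {m : ℝ}
    (hm : ∀ l : X →L[ℝ] ℝ, (∀ y τ, (y, τ) ∈ E → l (y - x) ≤ τ - a) → l u ≤ m) {t δ : ℝ}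
    (ht0 : 0 < t) (ht1 : t < 1) (hδ : 0 < δ) :
    ∃ s : ℝ, 0 < s ∧ (x + s • ((1 - t) • u + t • (x₀ - x)),
      a + s * ((1 - t) * m + t * (k - a) + δ)) ∈ E := by
  obtain ⟨l₀, hl₀, -⟩ := exists_subgradient_ge hE hx V hV q hq one_pos hM hc
  have hDc : Convex ℝ ((fun p : X × ℝ => p.1 - x) '' E) := by
    have := (hE.linear_image (LinearMap.fst ℝ X ℝ)).vadd (-x)
    convert this using 1
    ext y
    simp [Set.mem_vadd_set, sub_eq_neg_add]
  -- the cone of feasible directions at `x`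
  set D := ConvexCone.hull ℝ ((fun p : X × ℝ => p.1 - x) '' E) with hD
  have hmemD : ∀ d, d ∈ D ↔ ∃ s : ℝ, 0 < s ∧ ∃ τ, (x + s • d, τ) ∈ E := by
    intro d
    rw [hD, ConvexCone.mem_hull_of_convex hDc]
    constructor
    · rintro ⟨r, hr, _, ⟨⟨y, τ⟩, hy, rfl⟩, rfl⟩
      refine ⟨r⁻¹, inv_pos.2 hr, τ, ?_⟩
      simp only [smul_smul, inv_mul_cancel₀ hr.ne', one_smul, add_sub_cancel]
      exact hy
    · rintro ⟨s, hs, τ, h⟩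
      refine ⟨s⁻¹, inv_pos.2 hs, s • d, ⟨_, h, by simp⟩, ?_⟩
      simp [smul_smul, inv_mul_cancel₀ hs.ne']
  have hDV : (D : Set X) ⊆ V := by
    intro d hd
    obtain ⟨s, hs, τ, h⟩ := (hmemD d).1 hd
    have := hV _ _ h
    rw [add_sub_cancel_left] at this
    exact (V.smul_mem_iff hs.ne').1 this
  -- otherwise a functional separating `u` from the cone of feasible directions could be added to
  -- a subgradient arbitrarily many times, and subgradients would be unbounded at `u`
  have huD : u ∈ closure (D : Set X) := by
    by_contra hu
    obtain ⟨l, c', hl, hlu⟩ :=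
      geometric_hahn_banach_closed_point D.convex.closure isClosed_closure hu
    have h0 : (0 : X) ∈ D := (hmemD 0).2 ⟨1, one_pos, a, by simpa using hx⟩
    have hc'0 : 0 < c' := by simpa using hl 0 (subset_closure h0)
    have hlD : ∀ d ∈ D, l d ≤ 0 := by
      intro d hd
      by_contra hpos
      push Not at hpos
      have := hl _ (subset_closure (D.smul_mem (div_pos hc'0 hpos) hd))
      rw [map_smul, smul_eq_mul, div_mul_cancel₀ _ hpos.ne'] at this
      exact this.false
    have hlu0 : 0 < l u := hc'0.trans hlu
    set n := (|m - l₀ u| + 1) / l u with hn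
    have hn0 : 0 ≤ n := by positivity
    have := hm (l₀ + n • l) (fun y τ hy => by
      have h1 := hl₀ y τ hy
      have h2 := hlD (y - x) ((hmemD _).2 ⟨1, one_pos, τ, by simpa using hy⟩)
      have h3 := mul_nonpos_of_nonneg_of_nonpos hn0 h2
      simp only [add_apply, smul_apply, smul_eq_mul]
      linarith)
    simp only [add_apply, smul_apply, smul_eq_mul] at this
    rw [hn, div_mul_cancel₀ _ hlu0.ne'] at this
    have := le_abs_self (m - l₀ u)
    linarith
  have huV : u ∈ V := (closure_minimal hDV hVc) huD
  have h1t : 0 < 1 - t := sub_pos.2 ht1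
  obtain ⟨d, hdq, hdD⟩ : ∃ d, (1 - t) / t * q (u - d) < 1 ∧ d ∈ D := by
    have ho : IsOpen {d : X | (1 - t) / t * q (u - d) < 1} := by
      apply isOpen_lt _ continuous_const
      exact continuous_const.mul (hq.comp (continuous_const.sub continuous_id))
    have hu : u ∈ {d : X | (1 - t) / t * q (u - d) < 1} := by simp
    exact mem_closure_iff.1 huD _ ho hu
  obtain ⟨e, he⟩ : ∃ e, e = ((1 - t) / t) • (u - d) := ⟨_, rfl⟩
  have heV : e ∈ V := he ▸ V.smul_mem _ (V.sub_mem huV (hDV hdD))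
  have hqe : q e < 1 := by
    rwa [he, map_smul_eq_mul, Real.norm_of_nonneg (by positivity)]
  obtain ⟨s₀, hs₀, τ₀, hd₀⟩ := (hmemD d).1 hdD
  obtain ⟨s, hs, hs1, τ, hd⟩ : ∃ s : ℝ, 0 < s ∧ s ≤ 1 ∧ ∃ τ, (x + s • d, τ) ∈ E := by
    refine ⟨min s₀ 1, lt_min hs₀ one_pos, min_le_right _ _, _,
      descent_of_le hE hx (μ := (τ₀ - a) / s₀) (s := s₀) ?_ (lt_min hs₀ one_pos) (min_le_left _ _)⟩
    rw [mul_div_cancel₀ _ hs₀.ne', add_sub_cancel]; exact hd₀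
  obtain ⟨w, hw⟩ : ∃ w, w = (1 - t) • u + t • (x₀ - x) := ⟨_, rfl⟩
  rw [← hw]
  by_contra hcon
  push Not at hcon
  have htw : t • e = (1 - t) • (u - d) := by
    rw [he, smul_smul, mul_div_cancel₀ _ ht0.ne']
  -- near `x + s • w`, a convex combination of `x + s • d` and points close to `x₀`, the function
  -- is bounded
  have hball : ∀ v ∈ V, q v < (1 - q e) * (t * s) →
      ((x + s • w) + v, (1 - t) * τ + t * ((1 - s) * a + s * M)) ∈ E := by
    intro v hv hqv
    have hts : 0 < t * s := by positivity
    have h1 : q (e + (t * s)⁻¹ • v) < 1 := by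
      refine (map_add_le_add q _ _).trans_lt ?_
      rw [map_smul_eq_mul, Real.norm_of_nonneg (by positivity : 0 ≤ (t * s)⁻¹),
        inv_mul_eq_div]
      have := (div_lt_iff₀ hts).2 hqv
      linarith
    have h2 := hM _ (V.add_mem heV (V.smul_mem (t * s)⁻¹ hv)) h1
    have h3 := hE hx h2 (sub_nonneg.2 hs1) hs.le (by ring)
    have h4 := hE hd h3 h1t.le ht0.le (by ring)
    convert h4 using 1
    ext
    · simp only [Prod.fst_add, Prod.smul_fst]
      have h5 : v = t • s • (t * s)⁻¹ • v := by
        rw [smul_smul, smul_smul, mul_inv_cancel₀ hts.ne', one_smul]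
      have h6 : t • s • e = s • (1 - t) • (u - d) := by rw [smul_comm, htw]
      rw [smul_add s, smul_add s, smul_add t, smul_add t, smul_add t, ← h5, h6, hw]
      module
    · simp
  obtain ⟨l, hl, hlw⟩ := exists_subgradient_ge (x₁ := x + s • w)
    (c := s * ((1 - t) * m + t * (k - a) + δ)) hE hx V hV q hq
    (mul_pos (sub_pos.2 hqe) (mul_pos ht0 hs)) hball (fun s' τ' h0 h1 h => by
      rcases h0.eq_or_lt with rfl | h0
      · have h7 := hc 0 τ' le_rfl zero_le_one (by simpa using h)
        simpa using h7
      · rw [add_sub_cancel_left, smul_smul] at h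
        by_contra hlt
        push Not at hlt
        refine hcon (s' * s) (by positivity) (hup _ _ _ h ?_)
        rw [mul_assoc]; exact hlt.le)
  have h8 := hm l hl
  have h9 := hl _ _ hk
  rw [add_sub_cancel_left, map_smul, smul_eq_mul, hw, map_add, map_smul, map_smul] at hlw
  have h10 := le_of_mul_le_mul_left hlw hs
  simp only [smul_eq_mul] at h10
  have h11 := mul_le_mul_of_nonneg_left h8 h1t.le
  have h12 := mul_le_mul_of_nonneg_left h9 ht0.le
  linarith

/-! ### Finite sums of extended reals -/

theorem sum_le_coe_iff {T : Type*} {S : Finset T} {g : T → EReal} (hg : ∀ t ∈ S, ⊥ < g t) (σ : ℝ) :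
    ∑ t ∈ S, g t ≤ (σ : EReal) ↔
      ∃ τ : T → ℝ, (∀ t ∈ S, g t ≤ (τ t : EReal)) ∧ ∑ t ∈ S, τ t ≤ σ := by
  classical
  constructor
  · intro h
    -- the value `⊥` is excluded, so a sum below `⊤` has only finite terms
    have key : ∀ S : Finset T, (∀ t ∈ S, ⊥ < g t) → ⊥ < ∑ t ∈ S, g t ∧
        (∑ t ∈ S, g t < ⊤ → (∀ t ∈ S, g t = ((g t).toReal : EReal)) ∧
          ∑ t ∈ S, g t = ((∑ t ∈ S, (g t).toReal : ℝ) : EReal)) := by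
      intro S
      induction S using Finset.induction_on with
      | empty => intro _; simp
      | insert i S hi ih =>
        intro hg
        obtain ⟨ih1, ih2⟩ := ih fun t ht => hg t (Finset.mem_insert_of_mem ht)
        have hgi := hg i (Finset.mem_insert_self i S)
        rw [Finset.sum_insert hi, Finset.sum_insert hi]
        refine ⟨EReal.bot_lt_add_iff.2 ⟨hgi, ih1⟩, fun hlt => ?_⟩
        have h1 : g i ≠ ⊤ := by
          intro h
          rw [h, EReal.top_add_of_ne_bot ih1.ne'] at hlt
          exact hlt.false
        have h2 : ∑ t ∈ S, g t < ⊤ := by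
          rw [lt_top_iff_ne_top]
          intro h
          rw [h, EReal.add_top_of_ne_bot hgi.ne'] at hlt
          exact hlt.false
        obtain ⟨h3, h4⟩ := ih2 h2
        have h5 := (EReal.coe_toReal h1 hgi.ne').symm
        refine ⟨fun t ht => ?_, ?_⟩
        · rcases Finset.mem_insert.1 ht with rfl | ht
          · exact h5
          · exact h3 t ht
        · rw [h4, EReal.coe_add, ← h5]
    obtain ⟨h1, h2⟩ := (key S hg).2 (h.trans_lt (EReal.coe_lt_top σ))
    refine ⟨fun t => (g t).toReal, fun t ht => (h1 t ht).le, ?_⟩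
    rwa [h2, EReal.coe_le_coe_iff] at h
  · rintro ⟨τ, h1, h2⟩
    refine (Finset.sum_le_sum h1).trans ?_
    rw [← EReal.coe_le_coe_iff] at h2
    refine le_trans (le_of_eq ?_) h2
    have := map_sum (⟨⟨Real.toEReal, EReal.coe_zero⟩, EReal.coe_add⟩ : ℝ →+ EReal) τ S
    exact this.symm

theorem bot_lt_sum {T : Type*} {S : Finset T} {g : T → EReal} (hg : ∀ t ∈ S, ⊥ < g t) :
    ⊥ < ∑ t ∈ S, g t :=
  Finset.sum_induction g (⊥ < ·) (fun _ _ h h' => EReal.bot_lt_add_iff.2 ⟨h, h'⟩)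
    (EReal.bot_lt_zero) hg


/-! ### Subdifferentials in terms of epigraphs -/

theorem mem_epsSubdiff_iff {f : X → EReal} (hf : ∀ y, ⊥ < f y) {x : X} {a ε : ℝ}
    (ha : f x = (a : EReal)) (p : WeakDual ℝ X) :
    p ∈ epsSubdiff ε f x ↔ ∀ y (τ : ℝ), f y ≤ (τ : EReal) → p (y - x) ≤ τ - a + ε := by
  simp only [epsSubdiff, Set.mem_ofPred_eq, ha]
  refine ⟨fun h y τ hy => ?_, fun h => ⟨EReal.coe_ne_top _, EReal.coe_ne_bot _, fun y => ?_⟩⟩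
  · have h1 := h.2.2 y
    have h2 : f y - (a : EReal) + (ε : EReal) ≤ ((τ - a + ε : ℝ) : EReal) := by
      rw [EReal.coe_add, EReal.coe_sub]
      exact add_le_add_left (EReal.sub_le_sub hy le_rfl) _
    exact_mod_cast h1.trans h2
  · by_cases hy : f y = ⊤
    · rw [hy, EReal.top_sub_coe, EReal.top_add_coe]
      exact le_top
    · have h1 := EReal.coe_toReal hy (hf y).ne'
      have h2 := h y (f y).toReal h1.ge
      rw [← h1]
      exact_mod_cast h2

theorem mem_subdiff_sum_iff {T : Type*} {S : Finset T} {f : T → X → EReal}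
    (hf : ∀ t ∈ S, ∀ y, ⊥ < f t y) {x : X} {a : T → ℝ} (ha : ∀ t ∈ S, f t x = (a t : EReal))
    (p : WeakDual ℝ X) :
    p ∈ subdiff (fun y => ∑ t ∈ S, f t y) x ↔
      ∀ y (τ : T → ℝ), (∀ t ∈ S, f t y ≤ (τ t : EReal)) → p (y - x) ≤ ∑ t ∈ S, (τ t - a t) := by
  have hx : ∑ t ∈ S, f t x = ((∑ t ∈ S, a t : ℝ) : EReal) := by
    rw [Finset.sum_congr rfl ha]
    exact (map_sum (⟨⟨Real.toEReal, EReal.coe_zero⟩, EReal.coe_add⟩ : ℝ →+ EReal) a S).symm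
  rw [subdiff, mem_epsSubdiff_iff (fun y => bot_lt_sum fun t ht => hf t ht y) hx]
  constructor
  · intro h y τ hτ
    have := h y (∑ t ∈ S, τ t) ((sum_le_coe_iff (fun t ht => hf t ht y) _).2 ⟨τ, hτ, le_rfl⟩)
    rw [Finset.sum_sub_distrib]
    linarith
  · intro h y σ hσ
    obtain ⟨τ, hτ, hle⟩ := (sum_le_coe_iff (fun t ht => hf t ht y) _).1 hσ
    have := h y τ hτ
    rw [Finset.sum_sub_distrib] at this
    linarith

theorem eq_coe_of_mem_subdiff_sum {T : Type*} {S : Finset T} {f : T → X → EReal}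
    (hf : ∀ t ∈ S, ∀ y, ⊥ < f t y) {x : X} {p : WeakDual ℝ X}
    (hp : p ∈ subdiff (fun y => ∑ t ∈ S, f t y) x) :
    ∀ t ∈ S, f t x = ((f t x).toReal : EReal) := by
  intro t ht
  have h1 : ∑ t ∈ S, f t x ≠ ⊤ := hp.1
  have h2 : ∑ t ∈ S, f t x ≠ ⊥ := hp.2.1
  obtain ⟨τ, hτ, -⟩ := (sum_le_coe_iff (fun t ht => hf t ht x) _).1 (EReal.coe_toReal h1 h2).ge
  exact (EReal.coe_toReal ((hτ t ht).trans_lt (EReal.coe_lt_top _)).ne (hf t ht x).ne').symm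

theorem eq_coe_of_mem_epsSubdiff {f : X → EReal} {ε : ℝ} {x : X} {p : WeakDual ℝ X}
    (hp : p ∈ epsSubdiff ε f x) : f x = ((f x).toReal : EReal) :=
  (EReal.coe_toReal hp.1 hp.2.1).symm

theorem convex_epsSubdiff {f : X → EReal} (hf : ∀ y, ⊥ < f y) (ε : ℝ) (x : X) :
    Convex ℝ (epsSubdiff ε f x) := by
  intro p hp q hq s t hs ht hst
  have ha := eq_coe_of_mem_epsSubdiff hp
  rw [mem_epsSubdiff_iff hf ha] at hp hq ⊢
  intro y τ hy
  have h := convex_Iic (𝕜 := ℝ) _ (Set.mem_Iic.2 (hp y τ hy)) (Set.mem_Iic.2 (hq y τ hy)) hs ht hst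
  exact h

/-- Separation of a point from the weak-star closure of a sum of convex sets: the separating
functional is the evaluation at a point `u`, and the support function of a sum is the sum of the
support functions. -/
theorem exists_bound_of_notMem_closure_sum {T : Type*} [DecidableEq T] {S : Finset T}
    {A : T → Set (WeakDual ℝ X)} (hA : ∀ t ∈ S, Convex ℝ (A t)) (hne : ∀ t ∈ S, (A t).Nonempty)
    {p : WeakDual ℝ X} (hp : p ∉ closure (∑ t ∈ S, A t)) :
    ∃ (u : X) (m : T → ℝ), (∀ t ∈ S, ∀ q ∈ A t, q u ≤ m t) ∧ ∑ t ∈ S, m t < p u := by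
  have : LocallyConvexSpace ℝ (WeakDual ℝ X) :=
    inferInstanceAs (LocallyConvexSpace ℝ (WeakBilin (topDualPairing ℝ X)))
  obtain ⟨φ, c, hφ, hφp⟩ := geometric_hahn_banach_closed_point
    (convex_sum A hA).closure isClosed_closure hp
  obtain ⟨u, hu⟩ : ∃ u : X, ∀ q : WeakDual ℝ X, φ q = q u := by
    obtain ⟨u, hu⟩ := LinearMap.dualEmbedding_surjective (topDualPairing ℝ X) φ
    exact ⟨u, fun q => by rw [← hu]; rfl⟩
  have hle : ∀ q : T → WeakDual ℝ X, (∀ t ∈ S, q t ∈ A t) → ∑ t ∈ S, q t u < c := by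
    intro q hq
    have := hφ _ (subset_closure (Set.finsetSum_mem_finsetSum S A q hq))
    rw [map_sum] at this
    simpa only [hu] using this
  choose! q₀ hq₀ using hne
  have hbdd : ∀ t ∈ S, BddAbove ((fun q : WeakDual ℝ X => q u) '' A t) := by
    intro t ht
    refine ⟨c - ∑ s ∈ S.erase t, q₀ s u, ?_⟩
    rintro _ ⟨q, hq, rfl⟩
    have h := hle (Function.update q₀ t q) (fun s hs => by
      by_cases hst : s = t
      · subst hst; simpa using hq
      · simpa [hst] using hq₀ s hs)
    rw [← Finset.add_sum_erase _ _ ht, Function.update_self, Finset.sum_congr rfl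
      (fun s hs => by rw [Function.update_of_ne (Finset.ne_of_mem_erase hs)])] at h
    simp only
    linarith
  refine ⟨u, fun t => sSup ((fun q : WeakDual ℝ X => q u) '' A t),
    fun t ht q hq => le_csSup (hbdd t ht) ⟨q, hq, rfl⟩, ?_⟩
  rw [← hu p]
  refine lt_of_le_of_lt (le_of_forall_pos_le_add fun δ hδ => ?_) hφp
  have hδ' : 0 < δ / (S.card + 1) := by positivity
  have hex : ∀ t ∈ S, ∃ q ∈ A t,
      sSup ((fun q : WeakDual ℝ X => q u) '' A t) < q u + δ / (S.card + 1) := by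
    intro t ht
    obtain ⟨_, ⟨q, hq, rfl⟩, h⟩ := exists_lt_of_lt_csSup
      (Set.Nonempty.image (fun q : WeakDual ℝ X => q u) ⟨_, hq₀ t ht⟩)
      (sub_lt_self (sSup ((fun q : WeakDual ℝ X => q u) '' A t)) hδ')
    exact ⟨q, hq, by simp only at h; linarith⟩
  choose! q hqA hq using hex
  have h1 := Finset.sum_le_sum fun t ht => (hq t ht).le
  rw [Finset.sum_add_distrib, Finset.sum_const, nsmul_eq_mul] at h1
  have h2 := hle q hqA
  have h3 : (S.card : ℝ) * (δ / (S.card + 1)) ≤ δ := by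
    rw [← mul_div_assoc, div_le_iff₀ (by positivity)]
    nlinarith
  linarith

/-! ### Boundedness relative to a subspace -/

theorem IsGammaZero.isClosed_epi {f : X → EReal} (hf : IsGammaZero f) :
    IsClosed {p : X × ℝ | f p.1 ≤ (p.2 : EReal)} :=
  (lowerSemicontinuous_iff_isClosed_epigraph.1 hf.lsc).preimage
    (continuous_fst.prodMk (continuous_coe_real_ereal.comp continuous_snd))

/-- `f` is bounded above near `x₀` relative to a closed subspace that contains all differences
between points of the domain and `x₀`. The neighbourhood is a translate of the unit ball of a
continuous seminorm. -/
def IsRelBoundedNear (f : X → EReal) (x₀ : X) : Prop :=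
  ∃ (V : Submodule ℝ X) (q : Seminorm ℝ X) (M : ℝ), IsClosed (V : Set X) ∧ Continuous q ∧
    (∀ y ∈ dom f, y - x₀ ∈ V) ∧ ∀ v ∈ V, q v < 1 → f (x₀ + v) ≤ (M : EReal)

/-- The affine span of the domain need not be closed a priori. By lower semicontinuity the bound
extends from its direction to the closure of its direction. -/
theorem isRelBoundedNear_of_mem_intrinsicInterior [IsTopologicalAddGroup X] [ContinuousSMul ℝ X]
    [LocallyConvexSpace ℝ X] {f : X → EReal} (hf : IsGammaZero f) {x₀ : X}
    (hx₀ : x₀ ∈ intrinsicInterior ℝ (dom f)) (hc : ContinuousOn f (intrinsicInterior ℝ (dom f))) :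
    IsRelBoundedNear f x₀ := by
  have hdom : x₀ ∈ dom f := intrinsicInterior_subset hx₀
  obtain ⟨M, hM, -⟩ := EReal.lt_iff_exists_real_btwn.1 (show f x₀ < ⊤ from hdom)
  have hx₀A : x₀ ∈ affineSpan ℝ (dom f) := subset_affineSpan ℝ _ hdom
  have h1 : ∀ᶠ y in nhdsWithin x₀ (intrinsicInterior ℝ (dom f)), f y < M :=
    (hc x₀ hx₀).eventually (gt_mem_nhds hM)
  have h2 : intrinsicInterior ℝ (dom f) ∈ nhdsWithin x₀ (affineSpan ℝ (dom f) : Set X) := by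
    obtain ⟨z, hz, rfl⟩ := (mem_intrinsicInterior).1 hx₀
    rw [← map_nhds_subtype_val z]
    exact Filter.image_mem_map (isOpen_interior.mem_nhds hz)
  have h3 : {y | f y < M} ∈ nhdsWithin x₀ (affineSpan ℝ (dom f) : Set X) :=
    nhdsWithin_le_of_mem h2 h1
  obtain ⟨N, hN, hNM⟩ := mem_nhdsWithin_iff_exists_mem_nhds_inter.1 h3
  obtain ⟨q, hq, hqN⟩ := exists_continuous_seminorm_of_mem_nhds hN
  refine ⟨(affineSpan ℝ (dom f)).direction.topologicalClosure, q, M,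
    Submodule.isClosed_topologicalClosure _, hq, fun y hy => ?_, fun v hv hqv => ?_⟩
  · exact Submodule.le_topologicalClosure _
      (AffineSubspace.vsub_mem_direction (subset_affineSpan ℝ _ hy) hx₀A)
  · have hcl : IsClosed {v : X | f (x₀ + v) ≤ M} :=
      (hf.lsc.isClosed_preimage (M : EReal)).preimage (continuous_const.add continuous_id)
    have ho : IsOpen {v : X | q v < 1} := isOpen_lt hq continuous_const
    have hsub : {v : X | q v < 1} ∩ ((affineSpan ℝ (dom f)).direction : Set X) ⊆
        {v : X | f (x₀ + v) ≤ M} := by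
      rintro v ⟨hv1, hv2⟩
      refine le_of_lt (show f (x₀ + v) < M from hNM ⟨hqN v hv1, ?_⟩)
      have := AffineSubspace.vadd_mem_of_mem_direction hv2 hx₀A
      rwa [vadd_eq_add, add_comm] at this
    exact (closure_minimal hsub hcl) (ho.inter_closure ⟨hqv, hv⟩)

/-! ### Sum formulas -/

/-- The inclusion `⊆` of the first formula, for the functions indexed by `S`. -/
theorem mem_closure_sum_epsSubdiff [IsTopologicalAddGroup X] [ContinuousSMul ℝ X]
    [LocallyConvexSpace ℝ X] {T : Type*} [DecidableEq T] {S T₀ : Finset T} {f : T → X → EReal}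
    (hf : ∀ t ∈ S, IsGammaZero (f t)) {x x₀ : X} {a : T → ℝ}
    (ha : ∀ t ∈ S, f t x = (a t : EReal)) (hx₀ : ∀ t ∈ S, x₀ ∈ dom (f t))
    (hT₀ : ∀ t ∈ S, t ∈ T₀ → IsRelBoundedNear (f t) x₀) {p : WeakDual ℝ X}
    (hp : p ∈ subdiff (fun y => ∑ t ∈ S, f t y) x) {ε : ℝ} (hε : 0 < ε) :
    p ∈ closure (∑ t ∈ S, epsSubdiff (if t ∈ T₀ then 0 else ε) (f t) x) := by
  rw [mem_subdiff_sum_iff (fun t ht => (hf t ht).proper.2) ha] at hp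
  obtain ⟨k, hk⟩ : ∃ k : T → ℝ, ∀ t ∈ S, f t x₀ ≤ (k t : EReal) :=
    ⟨fun t => (f t x₀).toReal, fun t ht => EReal.le_coe_toReal (hx₀ t ht).ne⟩
  set E : T → Set (X × ℝ) := fun t => {p | f t p.1 ≤ (p.2 : EReal)} with hEdef
  have hE : ∀ t ∈ S, Convex ℝ (E t) := fun t ht => (hf t ht).convex
  have hEc : ∀ t ∈ S, IsClosed (E t) := fun t ht => (hf t ht).isClosed_epi
  have hup : ∀ t, ∀ y τ τ', (y, τ) ∈ E t → τ ≤ τ' → (y, τ') ∈ E t := fun t y τ τ' h h' =>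
    le_trans (show f t y ≤ (τ : EReal) from h) (EReal.coe_le_coe_iff.2 h')
  have hxE : ∀ t ∈ S, (x, a t) ∈ E t := fun t ht => (ha t ht).le
  have hkE : ∀ t ∈ S, (x₀, k t) ∈ E t := hk
  have hamin : ∀ t ∈ S, ∀ τ, (x, τ) ∈ E t → a t ≤ τ := fun t ht τ h => by
    have h : f t x ≤ (τ : EReal) := h
    rwa [ha t ht, EReal.coe_le_coe_iff] at h
  have hmem : ∀ t ∈ S, ∀ (η : ℝ) (l : X →L[ℝ] ℝ), StrongDual.toWeakDual l ∈ epsSubdiff η (f t) x ↔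
      ∀ y τ, (y, τ) ∈ E t → l (y - x) ≤ τ - a t + η := fun t ht η l =>
    mem_epsSubdiff_iff (hf t ht).proper.2 (ha t ht) _
  -- along the segment from `x` to `x₀` each summand decreases at most linearly, since the sum does
  -- and every other summand grows at most linearly by convexity
  have hslope : ∀ t ∈ S, ∀ s τ : ℝ, 0 ≤ s → s ≤ 1 → (x + s • (x₀ - x), τ) ∈ E t →
      a t + s * (p (x₀ - x) - ∑ i ∈ S.erase t, (k i - a i)) ≤ τ := by
    intro t ht s τ h0 h1 hτ
    have h := hp (x + s • (x₀ - x)) (Function.update (fun i => a i + s * (k i - a i)) t τ) (by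
      intro i hi
      by_cases hit : i = t
      · subst hit
        rw [Function.update_self]
        exact hτ
      · rw [Function.update_of_ne hit]
        have := hE i hi (hxE i hi) (hkE i hi) (sub_nonneg.2 h1) h0 (by ring)
        convert this using 1
        · simp only [hEdef, Set.mem_ofPred_eq, Prod.fst_add, Prod.smul_fst, Prod.snd_add,
            Prod.smul_snd, smul_eq_mul]
          rw [show x + s • (x₀ - x) = (1 - s) • x + s • x₀ by module,
            show a i + s * (k i - a i) = (1 - s) * a i + s * k i by ring])
    rw [← Finset.add_sum_erase _ _ ht, Function.update_self, Finset.sum_congr rfl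
      (fun i hi => by rw [Function.update_of_ne (Finset.ne_of_mem_erase hi), add_sub_cancel_left]),
      ← Finset.mul_sum, add_sub_cancel_left, map_smul, smul_eq_mul] at h
    linarith
  have hne : ∀ t ∈ S, (epsSubdiff (if t ∈ T₀ then 0 else ε) (f t) x).Nonempty := by
    intro t ht
    split_ifs with htT
    · obtain ⟨V, q, M, -, hq, hV, hM⟩ := hT₀ t ht htT
      have hV' : ∀ y τ, (y, τ) ∈ E t → y - x ∈ V := fun y τ hy => by
        have h1 := hV y (lt_of_le_of_lt hy (EReal.coe_lt_top τ))
        have h2 := hV x (lt_of_le_of_lt (hxE t ht) (EReal.coe_lt_top _))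
        simpa using V.sub_mem h1 h2
      obtain ⟨l, hl, -⟩ := exists_subgradient_ge (hE t ht) (hxE t ht) V hV' q hq one_pos hM
        (hslope t ht)
      exact ⟨StrongDual.toWeakDual l, (hmem t ht 0 l).2 (by simpa using hl)⟩
    · by_contra hemp
      obtain ⟨s, hs, h⟩ := exists_descent_of_epsSubgradient_le (hE t ht) (hEc t ht) (hup t)
        (hxE t ht) (hamin t ht) hε (u := 0) (m := -2)
        (fun l hl => (hemp ⟨StrongDual.toWeakDual l, (hmem t ht ε l).2 hl⟩).elim) one_pos
      have := hamin t ht _ (by simpa using h)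
      linarith
  by_contra hcl
  obtain ⟨u, m, hm, hlt⟩ := exists_bound_of_notMem_closure_sum
    (fun t ht => convex_epsSubdiff (hf t ht).proper.2 _ _) hne hcl
  -- every summand descends at the expected rate between the directions `u` and `x₀ - x`
  have hdesc : ∀ t ∈ S, ∀ r δ : ℝ, 0 < r → r < 1 → 0 < δ → ∃ s : ℝ, 0 < s ∧
      (x + s • ((1 - r) • u + r • (x₀ - x)),
        a t + s * ((1 - r) * m t + r * (k t - a t) + δ)) ∈ E t := by
    intro t ht r δ hr0 hr1 hδ
    have hmt := hm t ht
    by_cases htT : t ∈ T₀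
    · simp only [htT, if_true] at hmt
      obtain ⟨V, q, M, hVc, hq, hV, hM⟩ := hT₀ t ht htT
      have hV' : ∀ y τ, (y, τ) ∈ E t → y - x ∈ V := fun y τ hy => by
        have h1 := hV y (lt_of_le_of_lt hy (EReal.coe_lt_top τ))
        have h2 := hV x (lt_of_le_of_lt (hxE t ht) (EReal.coe_lt_top _))
        simpa using V.sub_mem h1 h2
      exact exists_descent_of_subgradient_le (hE t ht) (hup t) (hxE t ht) V hVc hV' q hq hM
        (hkE t ht) (hslope t ht)
        (fun l hl => hmt (StrongDual.toWeakDual l) ((hmem t ht 0 l).2 (by simpa using hl)))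
        hr0 hr1 hδ
    · simp only [htT, if_false] at hmt
      have h1 := exists_descent_of_epsSubgradient_le (hE t ht) (hEc t ht) (hup t)
        (hxE t ht) (hamin t ht) hε
        (fun l hl => hmt (StrongDual.toWeakDual l) ((hmem t ht ε l).2 hl)) hδ
      have h2 : ∃ s : ℝ, 0 < s ∧ (x + s • (x₀ - x), a t + s * (k t - a t)) ∈ E t :=
        ⟨1, one_pos, by simpa using hkE t ht⟩
      obtain ⟨s, hs, h⟩ := descent_combo (hE t ht) (hxE t ht) hr0.le hr1.le h1 h2
      refine ⟨s, hs, hup t _ _ _ h ?_⟩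
      have : (1 - r) * (m t + δ) ≤ (1 - r) * m t + δ := by nlinarith
      have := mul_le_mul_of_nonneg_left this hs.le
      linarith
  have hineq : ∀ r δ : ℝ, 0 < r → r < 1 → 0 < δ → (1 - r) * p u + r * p (x₀ - x) ≤
      (1 - r) * ∑ t ∈ S, m t + r * ∑ t ∈ S, (k t - a t) + S.card * δ := by
    intro r δ hr0 hr1 hδ
    set w := (1 - r) • u + r • (x₀ - x) with hw
    have hev : ∀ᶠ s in nhdsWithin (0 : ℝ) (Set.Ioi 0), ∀ t ∈ S,
        (x + s • w, a t + s * ((1 - r) * m t + r * (k t - a t) + δ)) ∈ E t := by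
      rw [Filter.eventually_all_finset]
      intro t ht
      obtain ⟨s₀, hs₀, h⟩ := hdesc t ht r δ hr0 hr1 hδ
      filter_upwards [Ioc_mem_nhdsGT hs₀] with s hs
      exact descent_of_le (hE t ht) (hxE t ht) h hs.1 hs.2
    obtain ⟨s, hs, hs0⟩ := (hev.and self_mem_nhdsWithin).exists
    have hs0 : 0 < s := hs0
    have h := hp (x + s • w) (fun t => a t + s * ((1 - r) * m t + r * (k t - a t) + δ)) hs
    simp only [add_sub_cancel_left] at h
    rw [map_smul, smul_eq_mul, ← Finset.mul_sum] at h
    have h' := le_of_mul_le_mul_left h hs0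
    rw [hw, map_add, map_smul, map_smul, smul_eq_mul, smul_eq_mul, Finset.sum_add_distrib,
      Finset.sum_add_distrib, ← Finset.mul_sum, ← Finset.mul_sum, Finset.sum_const,
      nsmul_eq_mul] at h'
    exact h'
  set G := p u - ∑ t ∈ S, m t with hG
  have hG0 : 0 < G := sub_pos.2 hlt
  set R := ∑ t ∈ S, (k t - a t) - p (x₀ - x) with hR
  -- with this `r`, and `δ` chosen below, each error term is at most a quarter of the gap `G`
  set r := G / (4 * (G + |R|)) with hr
  have hRn := abs_nonneg R
  have hr0 : 0 < r := by positivity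
  have hr1 : r ≤ 1 / 4 := by
    rw [hr, div_le_iff₀ (by positivity)]; linarith
  have hrR : r * R ≤ G / 4 := by
    have h1 : r * (G + |R|) = G / 4 := by rw [hr]; field_simp
    have h2 : r * R ≤ r * (G + |R|) := by
      gcongr; linarith [le_abs_self R]
    linarith
  have hδ0 : 0 < G / (4 * (S.card + 1)) := by positivity
  have h1 := hineq r _ hr0 (by linarith) hδ0
  have h2 : (S.card : ℝ) * (G / (4 * (S.card + 1))) ≤ G / 4 := by
    rw [← mul_div_assoc, div_le_div_iff₀ (by positivity) (by positivity)]
    nlinarith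
  have h3 : (1 - r) * G ≤ r * R + G / 4 := by rw [hG, hR]; linarith
  have h4 : 3 / 4 * G ≤ (1 - r) * G := by gcongr; linarith
  linarith

theorem mem_subdiff_sum_of_forall_mem_closure {T : Type*} [DecidableEq T] {S T₀ : Finset T}
    {f : T → X → EReal} (hf : ∀ t ∈ S, ∀ y, ⊥ < f t y) {x : X} {p : WeakDual ℝ X}
    (hp : ∀ ε : ℝ, 0 < ε →
      p ∈ closure (∑ t ∈ S, epsSubdiff (if t ∈ T₀ then 0 else ε) (f t) x)) :
    p ∈ subdiff (fun y => ∑ t ∈ S, f t y) x := by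
  have ha : ∀ t ∈ S, f t x = ((f t x).toReal : EReal) := by
    obtain ⟨q, hq⟩ := closure_nonempty_iff.1 ⟨p, hp 1 one_pos⟩
    obtain ⟨g, hg, -⟩ := (Set.mem_finsetSum S _ _).1 hq
    exact fun t ht => eq_coe_of_mem_epsSubdiff (hg ht)
  rw [mem_subdiff_sum_iff hf ha]
  intro y τ hτ
  have hε : ∀ ε : ℝ, 0 < ε → p (y - x) ≤ ∑ t ∈ S, (τ t - (f t x).toReal) + S.card * ε := by
    intro ε hε
    have hcl : IsClosed {q : WeakDual ℝ X |
        q (y - x) ≤ ∑ t ∈ S, (τ t - (f t x).toReal) + S.card * ε} :=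
      isClosed_le (WeakDual.eval_continuous _) continuous_const
    refine closure_minimal ?_ hcl (hp ε hε)
    intro q hq
    obtain ⟨g, hg, rfl⟩ := (Set.mem_finsetSum S _ _).1 hq
    have hsum : (∑ t ∈ S, g t) (y - x) = ∑ t ∈ S, g t (y - x) :=
      map_sum ((WeakBilin.eval (topDualPairing ℝ X)) (y - x)) g S
    simp only [Set.mem_ofPred_eq]
    rw [hsum, ← nsmul_eq_mul, ← Finset.sum_const, ← Finset.sum_add_distrib]
    refine Finset.sum_le_sum fun t ht => ?_
    have h1 := (mem_epsSubdiff_iff (hf t ht) (ha t ht) _).1 (hg ht) y (τ t) (hτ t ht)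
    refine h1.trans ?_
    split_ifs <;> linarith
  refine le_of_forall_pos_le_add fun δ hδ => (hε (δ / (S.card + 1)) (by positivity)).trans ?_
  gcongr
  rw [← mul_div_assoc, div_le_iff₀ (by positivity)]
  nlinarith

theorem subdiff_sum_eq_iInter_closure [IsTopologicalAddGroup X] [ContinuousSMul ℝ X]
    [LocallyConvexSpace ℝ X] {T : Type*} [DecidableEq T] {S T₀ : Finset T} {f : T → X → EReal}
    (hf : ∀ t ∈ S, IsGammaZero (f t)) {x₀ : X} (hx₀ : ∀ t ∈ S, x₀ ∈ dom (f t))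
    (hT₀ : ∀ t ∈ S, t ∈ T₀ → IsRelBoundedNear (f t) x₀) (x : X) :
    subdiff (fun y => ∑ t ∈ S, f t y) x = ⋂ (ε : ℝ) (_ : 0 < ε),
      closure (∑ t ∈ S, epsSubdiff (if t ∈ T₀ then 0 else ε) (f t) x) := by
  have hbot : ∀ t ∈ S, ∀ y, ⊥ < f t y := fun t ht => (hf t ht).proper.2
  refine Set.Subset.antisymm (fun p hp => ?_) (fun p hp => ?_)
  · simp only [Set.mem_iInter]
    exact fun ε hε => mem_closure_sum_epsSubdiff hf (eq_coe_of_mem_subdiff_sum hbot hp) hx₀ hT₀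
      hp hε
  · simp only [Set.mem_iInter] at hp
    exact mem_subdiff_sum_of_forall_mem_closure hbot hp

/-- The Hiriart-Urruty–Phelps formula, which needs no qualification condition beyond a common point
of the domains. -/
theorem subdiff_sum_eq_iInter_closure_epsSubdiff [IsTopologicalAddGroup X] [ContinuousSMul ℝ X]
    [LocallyConvexSpace ℝ X] {T : Type*} [DecidableEq T] {S : Finset T} {f : T → X → EReal}
    (hf : ∀ t ∈ S, IsGammaZero (f t)) {x₀ : X} (hx₀ : ∀ t ∈ S, x₀ ∈ dom (f t)) (x : X) :
    subdiff (fun y => ∑ t ∈ S, f t y) x = ⋂ (ε : ℝ) (_ : 0 < ε),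
      closure (∑ t ∈ S, epsSubdiff ε (f t) x) := by
  simpa using subdiff_sum_eq_iInter_closure (T₀ := ∅) hf hx₀ (by simp) x

/-- The Moreau–Rockafellar sum rule: functions that are continuous at an interior point of their
domain split off exactly. -/
theorem exists_add_of_mem_subdiff_sum [IsTopologicalAddGroup X] [ContinuousSMul ℝ X]
    [LocallyConvexSpace ℝ X] {T : Type*} [DecidableEq T] {f : T → X → EReal}
    (hf : ∀ t, IsGammaZero (f t)) {x x₀ : X} (S₁ S₀ : Finset T) (hd : Disjoint S₀ S₁)
    (h₁ : ∀ t ∈ S₁, x₀ ∈ dom (f t)) (h₀ : ∀ t ∈ S₀, x₀ ∈ interior (dom (f t)))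
    (hc : ∀ t ∈ S₀, ContinuousOn (f t) (interior (dom (f t)))) {p : WeakDual ℝ X}
    (hp : p ∈ subdiff (fun y => ∑ t ∈ S₀ ∪ S₁, f t y) x) :
    p ∈ (∑ t ∈ S₀, subdiff (f t) x) + subdiff (fun y => ∑ t ∈ S₁, f t y) x := by
  have hbot : ∀ t y, ⊥ < f t y := fun t => (hf t).proper.2
  induction S₀ using Finset.induction_on generalizing p with
  | empty => simpa using hp
  | insert i S hi ih =>
    have ha := eq_coe_of_mem_subdiff_sum (fun t _ => hbot t) hp
    rw [Finset.disjoint_insert_left] at hd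
    have hiS : i ∉ S ∪ S₁ := by simp [hi, hd.1]
    rw [Finset.insert_union] at hp ha
    rw [mem_subdiff_sum_iff (fun t _ => hbot t) ha] at hp
    have hai := ha i (Finset.mem_insert_self _ _)
    have ha' : ∀ t ∈ S ∪ S₁, f t x = ((f t x).toReal : EReal) :=
      fun t ht => ha t (Finset.mem_insert_of_mem ht)
    have hx₀i : x₀ ∈ interior (dom (f i)) := h₀ i (Finset.mem_insert_self _ _)
    have hdomi : x₀ ∈ dom (f i) := interior_subset hx₀i
    obtain ⟨M, hM, -⟩ := EReal.lt_iff_exists_real_btwn.1 (show f i x₀ < ⊤ from hdomi)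
    have hN : {y | f i y < M} ∈ nhds x₀ := by
      have h1 := (hc i (Finset.mem_insert_self _ _)).continuousAt (isOpen_interior.mem_nhds hx₀i)
      exact h1.eventually (gt_mem_nhds hM)
    obtain ⟨q, hq, hqN⟩ := exists_continuous_seminorm_of_mem_nhds hN
    have hball : ∀ v, q v < 1 → (x₀ + v, M) ∈ {w : X × ℝ | f i w.1 ≤ (w.2 : EReal)} :=
      fun v hv => le_of_lt (show f i (x₀ + v) < M from hqN v hv)
    -- the points above the graph of the sum of the remaining functions, in terms of the summands
    set G : Set (X × ℝ) := {w | ∃ τ : T → ℝ, (∀ t ∈ S ∪ S₁, f t w.1 ≤ (τ t : EReal)) ∧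
      w.2 = ∑ t ∈ S ∪ S₁, τ t} with hG
    have hGc : Convex ℝ G := by
      rintro w ⟨τ, hτ, hw⟩ w' ⟨τ', hτ', hw'⟩ s t hs ht hst
      refine ⟨fun j => s * τ j + t * τ' j, fun j hj => ?_, ?_⟩
      · exact (hf j).convex (x := (w.1, τ j)) (y := (w'.1, τ' j)) (hτ j hj) (hτ' j hj) hs ht hst
      · rw [Finset.sum_add_distrib, ← Finset.mul_sum, ← Finset.mul_sum, ← hw, ← hw']
        simp
    have hmemG : ∀ y (τ : T → ℝ), (∀ t ∈ S ∪ S₁, f t y ≤ (τ t : EReal)) →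
        (y, ∑ t ∈ S ∪ S₁, τ t) ∈ G := fun y τ h => ⟨τ, h, rfl⟩
    have hx₀G : ∀ t ∈ S ∪ S₁, f t x₀ ≤ ((f t x₀).toReal : EReal) := by
      intro t ht
      have hdom : x₀ ∈ dom (f t) := by
        rcases Finset.mem_union.1 ht with ht | ht
        · exact interior_subset (h₀ t (Finset.mem_insert_of_mem ht))
        · exact h₁ t ht
      exact EReal.le_coe_toReal (LT.lt.ne hdom)
    obtain ⟨l, hl, hlG⟩ := exists_separating_subgradient (r := 1) (hf i).convex hGc
      (x := x) (x₀ := x₀) (a := (f i x).toReal) hai.le (hmemG x _ fun t ht => (ha' t ht).le)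
      (WeakDual.toStrongDual p) (by
        rintro y τ σ hy ⟨τ', hτ', rfl⟩
        have h := hp y (Function.update τ' i τ) (by
          intro t ht
          by_cases hti : t = i
          · subst hti; simpa using hy
          · rw [Function.update_of_ne hti]
            exact hτ' t (Finset.mem_of_mem_insert_of_ne ht hti))
        rw [Finset.sum_insert hiS, Function.update_self, Finset.sum_congr rfl (fun t ht => by
          rw [Function.update_of_ne (ne_of_mem_of_not_mem ht hiS)]),
          Finset.sum_sub_distrib] at h
        rw [WeakDual.toStrongDual_apply]
        linarith) ⊤ q hq one_pos (fun v _ hv => hball v hv) (hmemG x₀ _ hx₀G) (by simp)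
    have hp' : p - StrongDual.toWeakDual l ∈ subdiff (fun y => ∑ t ∈ S ∪ S₁, f t y) x := by
      rw [mem_subdiff_sum_iff (fun t _ => hbot t) ha']
      intro y τ hτ
      rw [Finset.sum_sub_distrib]
      exact hlG y _ (hmemG y τ hτ)
    obtain ⟨q', hq', r', hr', hqr⟩ := ih hd.2 (fun t ht => h₀ t (Finset.mem_insert_of_mem ht))
      (fun t ht => hc t (Finset.mem_insert_of_mem ht)) hp'
    rw [Finset.sum_insert hi]
    refine ⟨StrongDual.toWeakDual l + q', ⟨_, ?_, q', hq', rfl⟩, r', hr', ?_⟩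
    · rw [subdiff, mem_epsSubdiff_iff (hbot i) hai]
      simpa using hl
    · simp only at hqr ⊢
      rw [add_assoc, hqr, add_sub_cancel]

theorem sum_subdiff_add_subset {T : Type*} [DecidableEq T] {f : T → X → EReal}
    (hf : ∀ t y, ⊥ < f t y) {x : X} {S₀ S₁ : Finset T} (hd : Disjoint S₀ S₁) :
    (∑ t ∈ S₀, subdiff (f t) x) + subdiff (fun y => ∑ t ∈ S₁, f t y) x ⊆
      subdiff (fun y => ∑ t ∈ S₀ ∪ S₁, f t y) x := by
  rintro _ ⟨q, hq, r, hr, rfl⟩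
  obtain ⟨g, hg, rfl⟩ := (Set.mem_finsetSum S₀ _ _).1 hq
  have ha₁ := eq_coe_of_mem_subdiff_sum (fun t _ => hf t) hr
  have ha₀ : ∀ t ∈ S₀, f t x = ((f t x).toReal : EReal) :=
    fun t ht => eq_coe_of_mem_epsSubdiff (hg ht)
  rw [mem_subdiff_sum_iff (fun t _ => hf t) ha₁] at hr
  rw [mem_subdiff_sum_iff (fun t _ => hf t) (a := fun t => (f t x).toReal)
    (fun t ht => (Finset.mem_union.1 ht).elim (ha₀ t) (ha₁ t))]
  intro y τ hτ
  rw [Finset.sum_union hd]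
  have hsum : (∑ t ∈ S₀, g t) (y - x) = ∑ t ∈ S₀, g t (y - x) :=
    map_sum ((WeakBilin.eval (topDualPairing ℝ X)) (y - x)) g S₀
  have h1 := hr y τ fun t ht => hτ t (Finset.mem_union_right _ ht)
  have h2 : ∑ t ∈ S₀, g t (y - x) ≤ ∑ t ∈ S₀, (τ t - (f t x).toReal) :=
    Finset.sum_le_sum fun t ht => by
      have h := (mem_epsSubdiff_iff (hf t) (ha₀ t ht) _).1 (hg ht) y (τ t)
        (hτ t (Finset.mem_union_left _ ht))
      rwa [add_zero] at h
  rw [← hsum] at h2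
  exact add_le_add h2 h1

end ConvexSum

theorem mainTheorem7 {X : Type*} [AddCommGroup X] [Module ℝ X] [TopologicalSpace X]
    [IsTopologicalAddGroup X] [ContinuousSMul ℝ X] [LocallyConvexSpace ℝ X] [T2Space X]
    {T : Type*} [Fintype T] [DecidableEq T] (f : T → X → EReal)
    (hf : ∀ t, ConvexSum.IsGammaZero (f t)) (T₀ : Finset T) :
    (((⋂ t ∈ T₀, intrinsicInterior ℝ (ConvexSum.dom (f t))) ∩
          ⋂ t ∈ T₀ᶜ, ConvexSum.dom (f t)).Nonempty →
      (∀ t ∈ T₀, ContinuousOn (f t) (intrinsicInterior ℝ (ConvexSum.dom (f t)))) →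
      ∀ x : X, ConvexSum.subdiff (fun y => ∑ t, f t y) x =
        ⋂ (ε : ℝ) (_ : 0 < ε), closure
          ((∑ t ∈ T₀, ConvexSum.subdiff (f t) x) +
            (∑ t ∈ T₀ᶜ, ConvexSum.epsSubdiff ε (f t) x))) ∧
    (((⋂ t ∈ T₀, interior (ConvexSum.dom (f t))) ∩
          ⋂ t ∈ T₀ᶜ, ConvexSum.dom (f t)).Nonempty →
      (∀ t ∈ T₀, ContinuousOn (f t) (interior (ConvexSum.dom (f t)))) →
      ∀ x : X, ConvexSum.subdiff (fun y => ∑ t, f t y) x =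
        (∑ t ∈ T₀, ConvexSum.subdiff (f t) x) +
          (⋂ (ε : ℝ) (_ : 0 < ε), closure
            (∑ t ∈ T₀ᶜ, ConvexSum.epsSubdiff ε (f t) x))) := by
  constructor
  · rintro ⟨x₀, h₀, h₁⟩ hc x
    simp only [Set.mem_iInter] at h₀ h₁
    have hdom : ∀ t ∈ Finset.univ, x₀ ∈ ConvexSum.dom (f t) := fun t _ => by
      by_cases ht : t ∈ T₀
      · exact intrinsicInterior_subset (h₀ t ht)
      · exact h₁ t (Finset.mem_compl.2 ht)
    rw [ConvexSum.subdiff_sum_eq_iInter_closure (T₀ := T₀) (fun t _ => hf t) hdom (fun t _ ht =>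
      ConvexSum.isRelBoundedNear_of_mem_intrinsicInterior (hf t) (h₀ t ht) (hc t ht)) x]
    refine Set.iInter₂_congr fun ε _ => ?_
    rw [← Finset.sum_add_sum_compl T₀]
    congr 2
    · exact Finset.sum_congr rfl fun t ht => by rw [if_pos ht, ConvexSum.subdiff]
    · exact Finset.sum_congr rfl fun t ht => by rw [if_neg (Finset.mem_compl.1 ht)]
  · rintro ⟨x₀, h₀, h₁⟩ hc x
    simp only [Set.mem_iInter] at h₀ h₁
    rw [← ConvexSum.subdiff_sum_eq_iInter_closure_epsSubdiff (fun t _ => hf t) h₁ x,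
      ← Finset.union_compl T₀]
    exact Set.Subset.antisymm
      (fun p hp => ConvexSum.exists_add_of_mem_subdiff_sum hf _ _ disjoint_compl_right h₁ h₀ hc hp)
      (ConvexSum.sum_subdiff_add_subset (fun t => (hf t).proper.2) disjoint_compl_right)
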